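/- Let $W=\mathbb C^{N+1}$, and let $F\in\operatorname{Sym}^3W^*$ be an irreducible cubic form, also regarded as a symmetric trilinear form $F(\cdot,\cdot,\cdot)$ on $W$. Let $Y\subset\mathbb P W=\mathbb P^N$ be the irreducible cubic hypersurface defined by $F$, let $\hat Y=\{w\in W\mid F(w,w,w)=0\}$ be its affine cone, and let $\operatorname{Sm}\hat Y=\{y\in\hat Y\mid F(y,y,\cdot)\ne0\}$ be the smooth locus of $\hat Y$, whose tangent space at $y\in\operatorname{Sm}\hat Y$ is $T_{\hat Y,y}=\{v\in W\mid F(y,y,v)=0\}$. Put $$\mathfrak{aut}\,\hat Y=\{g\in\mathfrak{gl}(W)\mid g(y)\in T_{\hat Y,y}\ \ \forall\,y\in\operatorname{Sm}\hat Y\},$$ and let $\mathfrak{aut}^1\hat Y$ be the space of its prolongations, that is, of all symmetric bilinear maps $A:W\times W\to W$ such that $A(w,\cdot)\in\mathfrak{aut}\,\hat Y$ for every $w\in W$. Let $X=Y^*\subset\mathbb P(W^*)$ be the dual variety of $Y$, i.e. the Zariski closure of the set of the points $[F(y,y,\cdot)]$, $y\in\operatorname{Sm}\hat Y$ (the tangent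 hyperplanes at the smooth points of $Y$). If $\mathfrak{aut}^1\hat Y\ne0$, then $Y$ is dual defective, i.e. $X$ is not a hypersurface: $\dim X<N-1$. Moreover, for every $y\in\operatorname{Sm}\hat Y$ the symmetric bilinear form $F_y=F(y,\cdot,\cdot)$ on $W$ is degenerate, and there is a vector $v\in W$, not a scalar multiple of $y$, such that $F(y,v,w)=0$ for all $w\in W$. -/

import Mathlib

open MvPolynomial
open scoped LinearAlgebra.Projectivization Matrix

noncomputable section

namespace CubicHypersurface

/-- The space `W = ℂ^(N+1)`, with coordinates indexed by `Fin (N + 1)`; its dual `W*` is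
identified with the same space by means of the dual basis. -/
abbrev W (N : ℕ) : Type := Fin (N + 1) → ℂ

/-! ### Zariski closed sets in projective space -/

/-- The homogeneous ideal of a set `S` of points of `ℙ^N`: the ideal generated by the homogeneous
polynomials that vanish at all points of `S`. -/
def homogeneousIdeal {N : ℕ} (S : Set (ℙ ℂ (W N))) : Ideal (MvPolynomial (Fin (N + 1)) ℂ) :=
  Ideal.span {G | (∃ d : ℕ, G.IsHomogeneous d) ∧ ∀ p ∈ S, eval p.rep G = 0}

/-- The Zariski closure in `ℙ^N` of a set of points: the common zeros of all homogeneous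
polynomials that vanish on it. -/
def zariskiClosure {N : ℕ} (S : Set (ℙ ℂ (W N))) : Set (ℙ ℂ (W N)) :=
  {p | ∀ (d : ℕ) (G : MvPolynomial (Fin (N + 1)) ℂ), G.IsHomogeneous d →
    (∀ q ∈ S, eval q.rep G = 0) → eval p.rep G = 0}

/-- The dimension of the affine cone over a closed subset `X` of `ℙ^N`, that is, the Krull
dimension of the homogeneous coordinate ring of `X`. For nonempty `X` it is equal to
`dim X + 1`. -/
def coneDim {N : ℕ} (X : Set (ℙ ℂ (W N))) : WithBot ℕ∞ :=
  ringKrullDim (MvPolynomial (Fin (N + 1)) ℂ ⧸ homogeneousIdeal X)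

/-! ### The hypersurface `Y ⊆ ℙ^N` defined by `F`, its affine cone and its dual variety -/

/-- The vector of partial derivatives of `F` at `w`, i.e. the differential of `F` at `w` written
in the dual basis of `W*`. For a cubic form it equals `3 F(w, w, ·)`; it is the affine polar
map up to this constant factor. -/
def gradient {N : ℕ} (F : MvPolynomial (Fin (N + 1)) ℂ) (w : W N) : W N :=
  fun i => eval w (pderiv i F)

/-- The Hesse matrix of `F` at `w`. For a cubic form it is the matrix of the symmetric bilinear
form `6 F(w, ·, ·)`. -/
def hesseMatrix {N : ℕ} (F : MvPolynomial (Fin (N + 1)) ℂ) (w : W N) :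
    Matrix (Fin (N + 1)) (Fin (N + 1)) ℂ :=
  Matrix.of fun i j => eval w (pderiv i (pderiv j F))

/-- The affine cone `Ŷ` of the hypersurface `Y` with equation `F = 0`. -/
def affineCone {N : ℕ} (F : MvPolynomial (Fin (N + 1)) ℂ) : Set (W N) :=
  {w | eval w F = 0}

/-- The smooth locus `Sm Ŷ` of the affine cone, where `F` is a reduced equation. -/
def smoothLocus {N : ℕ} (F : MvPolynomial (Fin (N + 1)) ℂ) : Set (W N) :=
  {y | y ∈ affineCone F ∧ gradient F y ≠ 0}

/-- The tangent space of the affine cone at a smooth point `y`, as a linear subspace of `W`: the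
kernel of the differential of `F` at `y`. -/
def tangentSpace {N : ℕ} (F : MvPolynomial (Fin (N + 1)) ℂ) (y : W N) : Submodule ℂ (W N) :=
  LinearMap.ker (∑ i, gradient F y i • (LinearMap.proj i : W N →ₗ[ℂ] ℂ))

/-- The image of the Gauss map of `Y`: the set of the points of the dual projective space that
are represented by the embedded tangent hyperplanes at the smooth points of `Y`. -/
def gaussImage {N : ℕ} (F : MvPolynomial (Fin (N + 1)) ℂ) : Set (ℙ ℂ (W N)) :=
  {ξ | ∃ (y : W N) (h : y ∈ smoothLocus F), ξ = Projectivization.mk ℂ (gradient F y) h.2}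

/-- The dual variety `X = Y*`, a closed subset of the dual projective space. -/
def dualVariety {N : ℕ} (F : MvPolynomial (Fin (N + 1)) ℂ) : Set (ℙ ℂ (W N)) :=
  zariskiClosure (gaussImage F)

/-- `Y` is dual defective if its dual variety `X` fails to be a hypersurface, i.e. if the dual
defect `N - 1 - dim X` is positive. -/
def IsDualDefective {N : ℕ} (F : MvPolynomial (Fin (N + 1)) ℂ) : Prop :=
  coneDim (dualVariety F) < (N : WithBot ℕ∞)

/-! ### Infinitesimal linear automorphisms and prolongations -/

/-- The infinitesimal linear automorphisms of the affine cone `Ŷ`: all `g ∈ gl(W)` such that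
`g y` is tangent to `Ŷ` at `y` for each smooth point `y` of `Ŷ`. -/
def infAut {N : ℕ} (F : MvPolynomial (Fin (N + 1)) ℂ) : Submodule ℂ (Module.End ℂ (W N)) where
  carrier := {g | ∀ y ∈ smoothLocus F, g y ∈ tangentSpace F y}
  add_mem' := fun ha hb y hy => (tangentSpace F y).add_mem (ha y hy) (hb y hy)
  zero_mem' := fun y _ => (tangentSpace F y).zero_mem
  smul_mem' := fun c _ ha y hy => (tangentSpace F y).smul_mem c (ha y hy)

/-- The space `𝔤¹` of prolongations of a linear subspace `𝔤` of `gl(W)`: the elements of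
`Hom(Sym² W, W)`, viewed as symmetric bilinear maps `A : W × W → W`, such that `A(w, ·) ∈ 𝔤` for
every `w ∈ W`. -/
def prolongation {N : ℕ} (g : Submodule ℂ (Module.End ℂ (W N))) :
    Submodule ℂ (W N →ₗ[ℂ] W N →ₗ[ℂ] W N) where
  carrier := {A | (∀ u w, A u w = A w u) ∧ ∀ w, A w ∈ g}
  add_mem' := fun {a b} ha hb =>
    ⟨fun u w => by simp [ha.1 u w, hb.1 u w], fun w => g.add_mem (ha.2 w) (hb.2 w)⟩
  zero_mem' := ⟨fun _ _ => rfl, fun _ => g.zero_mem⟩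
  smul_mem' := fun c a ha =>
    ⟨fun u w => by simp [ha.1 u w], fun w => g.smul_mem c (ha.2 w)⟩

end CubicHypersurface

end

/-! ### The Hessian determinant vanishes on the hypersurface. -/

noncomputable section

namespace CubicHypersurface

variable {N : ℕ}

/-! For a prolongation `A`, the cubic `∇F(y)·A(e_k, y)` vanishes on the cone, so it equals `c_k F`.
Differentiating, contracting with `y` and using the symmetry of `A` gives `H Q = L ∇F - F c`, with
`Q = A(y, y)`, `L = ∑ c_k y_k` and `H` the Hesse matrix. Since `H y = 2 ∇F`, the quadratic field `V
= 2Q - L y` satisfies `H V ≡ 0` mod `F`. If `F ∤ det H`, then `F` divides the quadrics `V_i`, so `V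
= 0`; this forces `c = 0`, `Q = 0` and `A = 0`. Hence `F ∣ det H` (`dvd_det_hessePoly`).

The kernel vector follows, as `H y = 2 ∇F ≠ 0` at smooth points. For the defect, the differentials
of the partials at the generic point span a space of dimension at most `N - 1`, which in
characteristic zero bounds the dimension of the cone over the dual variety
(`card_lt_of_algebraicIndependent`). -/

/-- The vector of partial derivatives of `F`, as polynomials. -/
def gradPoly (F : MvPolynomial (Fin (N + 1)) ℂ) : Fin (N + 1) → MvPolynomial (Fin (N + 1)) ℂ :=
  fun i => pderiv i F

/-- The Hesse matrix of `F`, as a matrix of polynomials. -/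
def hessePoly (F : MvPolynomial (Fin (N + 1)) ℂ) :
    Matrix (Fin (N + 1)) (Fin (N + 1)) (MvPolynomial (Fin (N + 1)) ℂ) :=
  Matrix.of fun i j => pderiv i (pderiv j F)

theorem gradient_eq_eval (F : MvPolynomial (Fin (N + 1)) ℂ) (y : W N) :
    gradient F y = fun i => eval y (gradPoly F i) := rfl

/-- Partial derivatives commute. -/
theorem pderiv_comm {σ R : Type*} [CommRing R] (i j : σ) (P : MvPolynomial σ R) :
    pderiv i (pderiv j P) = pderiv j (pderiv i P) := by
  classical
  have h : ⁅pderiv (R := R) i, pderiv (R := R) j⁆ = 0 :=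
    derivation_ext fun k => by
      simp [Derivation.commutator_apply, pderiv_X, Pi.single_apply, apply_ite]
  have h1 := Derivation.congr_fun h P
  rw [Derivation.commutator_apply] at h1
  exact sub_eq_zero.1 h1

/-- Euler's identity for the partial derivatives of a cubic form. -/
theorem hessePoly_mulVec_X {F : MvPolynomial (Fin (N + 1)) ℂ} (hF : F.IsHomogeneous 3) :
    hessePoly F *ᵥ X = (2 : MvPolynomial (Fin (N + 1)) ℂ) • gradPoly F := by
  funext i
  have h := (hF.pderiv (i := i)).sum_X_mul_pderiv
  simp only [Matrix.mulVec, dotProduct, hessePoly, Matrix.of_apply, gradPoly, Pi.smul_apply,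
    smul_eq_mul]
  norm_num at h
  rw [← h]
  refine Finset.sum_congr rfl fun j _ => ?_
  rw [mul_comm, pderiv_comm]

theorem hesseMatrix_mulVec_self {F : MvPolynomial (Fin (N + 1)) ℂ} (hF : F.IsHomogeneous 3)
    (y : W N) : hesseMatrix F y *ᵥ y = (2 : ℂ) • gradient F y := by
  funext i
  have h := congrArg (eval y) (congrFun (hessePoly_mulVec_X hF) i)
  simpa [Matrix.mulVec, dotProduct, hesseMatrix, hessePoly, gradient, gradPoly] using h

/-- A polynomial that vanishes on an irreducible hypersurface is a multiple of its equation. -/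
theorem dvd_of_eval_eq_zero {σ : Type*} [Finite σ] {F G : MvPolynomial σ ℂ} (hirr : Irreducible F)
    (h : ∀ y : σ → ℂ, eval y F = 0 → eval y G = 0) : F ∣ G := by
  have hp : (Ideal.span {F}).IsPrime :=
    (Ideal.span_singleton_prime hirr.ne_zero).2 hirr.prime
  -- Nullstellensatz: a prime ideal is the vanishing ideal of its zero locus.
  rw [← Ideal.mem_span_singleton, ← IsPrime.vanishingIdeal_zeroLocus (K := ℂ) (Ideal.span {F})]
  intro y hy
  have := h y (by simpa [coe_aeval_eq_eval] using hy F (Ideal.mem_span_singleton_self F))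
  simpa [coe_aeval_eq_eval] using this

/-- A form of degree `m` divisible by a form of degree `n > m` is zero. -/
theorem eq_zero_of_dvd_of_lt {σ : Type*} {F G : MvPolynomial σ ℂ} {m n : ℕ}
    (hF : F.IsHomogeneous n) (hG : G.IsHomogeneous m) (hmn : m < n) (h : F ∣ G) : G = 0 := by
  by_contra h0
  obtain ⟨P, rfl⟩ := h
  have hP : P ≠ 0 := right_ne_zero_of_mul h0
  have hF0 : F ≠ 0 := left_ne_zero_of_mul h0
  have h1 := hG.totalDegree h0
  rw [totalDegree_mul_of_isDomain hF0 hP, hF.totalDegree hF0] at h1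
  omega

/-- A form divisible by a form of the same degree is a constant multiple of it. -/
theorem eq_C_mul_of_dvd {σ : Type*} {F G : MvPolynomial σ ℂ} {n : ℕ}
    (hF : F.IsHomogeneous n) (hG : G.IsHomogeneous n) (h : F ∣ G) : ∃ c : ℂ, G = C c * F := by
  obtain ⟨P, rfl⟩ := h
  by_cases h0 : F * P = 0
  · exact ⟨0, by simp [h0]⟩
  have hP : P ≠ 0 := right_ne_zero_of_mul h0
  have hF0 : F ≠ 0 := left_ne_zero_of_mul h0
  have h1 := hG.totalDegree h0
  rw [totalDegree_mul_of_isDomain hF0 hP, hF.totalDegree hF0] at h1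
  refine ⟨coeff 0 P, ?_⟩
  rw [← totalDegree_eq_zero_iff_eq_C.1 (by omega : P.totalDegree = 0), mul_comm]

/-- The coordinates of the linear map `A(u, ·)` as linear forms. -/
def linForms (A : W N →ₗ[ℂ] W N →ₗ[ℂ] W N) (k : Fin (N + 1)) :
    Fin (N + 1) → MvPolynomial (Fin (N + 1)) ℂ :=
  fun i => ∑ j, C (A (Pi.single k 1) (Pi.single j 1) i) * X j

theorem linForms_isHomogeneous (A : W N →ₗ[ℂ] W N →ₗ[ℂ] W N) (k i : Fin (N + 1)) :
    (linForms A k i).IsHomogeneous 1 :=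
  IsHomogeneous.sum _ _ _ fun _ _ => isHomogeneous_C_mul_X _ _

theorem pderiv_linForms (A : W N →ₗ[ℂ] W N →ₗ[ℂ] W N) (k i l : Fin (N + 1)) :
    pderiv l (linForms A k i) = C (A (Pi.single k 1) (Pi.single l 1) i) := by
  simp [linForms, pderiv_X, Pi.single_apply]

theorem eval_linForms (A : W N →ₗ[ℂ] W N →ₗ[ℂ] W N) (k i : Fin (N + 1)) (y : W N) :
    eval y (linForms A k i) = A (Pi.single k 1) y i := by
  conv_rhs => rw [pi_eq_sum_univ' y]
  simp [linForms, mul_comm, Finset.sum_apply]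

/-- The cubic form `F(y, y, A(e_k, y))` is a multiple of `F` for a prolongation `A`. -/
theorem exists_sum_gradPoly_mul_linForms {F : MvPolynomial (Fin (N + 1)) ℂ}
    (hF : F.IsHomogeneous 3) (hirr : Irreducible F) {A : W N →ₗ[ℂ] W N →ₗ[ℂ] W N}
    (hA : A ∈ prolongation (infAut F)) (k : Fin (N + 1)) :
    ∃ c : ℂ, ∑ i, gradPoly F i * linForms A k i = C c * F := by
  refine eq_C_mul_of_dvd hF (IsHomogeneous.sum _ _ _ fun i _ =>
    (hF.pderiv (i := i)).mul (linForms_isHomogeneous A k i)) (dvd_of_eval_eq_zero hirr ?_)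
  intro y hy
  -- Tangency is given only at smooth points; at singular ones every summand vanishes.
  by_cases hg : gradient F y = 0
  · simp only [map_sum, map_mul]
    refine Finset.sum_eq_zero fun i _ => ?_
    have : eval y (gradPoly F i) = 0 := congrFun hg i
    rw [this, zero_mul]
  · have h := hA.2 (Pi.single k 1) y ⟨hy, hg⟩
    simpa [tangentSpace, eval_linForms, gradient_eq_eval] using h

/-- If the cone over an irreducible cubic hypersurface has a nonzero prolongation, the Hessian
vanishes on the hypersurface. -/
theorem dvd_det_hessePoly {F : MvPolynomial (Fin (N + 1)) ℂ}
    (hF : F.IsHomogeneous 3) (hirr : Irreducible F) {A : W N →ₗ[ℂ] W N →ₗ[ℂ] W N}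
    (hA : A ∈ prolongation (infAut F)) (hA0 : A ≠ 0) : F ∣ (hessePoly F).det := by
  choose c hc using exists_sum_gradPoly_mul_linForms hF hirr hA
  set L : MvPolynomial (Fin (N + 1)) ℂ := ∑ k, C (c k) * X k with hL
  set Q : Fin (N + 1) → MvPolynomial (Fin (N + 1)) ℂ := fun i => ∑ k, X k * linForms A k i with hQ
  -- Modulo `F`, `H Q` is `L ∇F` and `H X` is `2 ∇F`, so this combination cancels the gradient
  -- terms.
  set V : Fin (N + 1) → MvPolynomial (Fin (N + 1)) ℂ := (2 : MvPolynomial (Fin (N + 1)) ℂ) • Q - L • X with hV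
  have hder : ∀ k l, ∑ i, (hessePoly F l i * linForms A k i +
      gradPoly F i * C (A (Pi.single k 1) (Pi.single l 1) i)) = C (c k) * gradPoly F l := by
    intro k l
    have h := congrArg (pderiv l) (hc k)
    rw [map_sum, pderiv_C_mul] at h
    rw [gradPoly, ← h]
    refine Finset.sum_congr rfl fun i _ => ?_
    rw [pderiv_mul, pderiv_linForms]
    rfl
  -- Weight `hder k l` by `X k` and sum over `k`; by symmetry of `A`, the terms without `H` add up
  -- to `hc l`.
  have hHQ : ∀ l, (hessePoly F *ᵥ Q) l + C (c l) * F = L * gradPoly F l := by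
    intro l
    rw [← hc l, hL, Finset.sum_mul]
    have : ∀ k, C (c k) * X k * gradPoly F l = ∑ i, (hessePoly F l i * (X k * linForms A k i) +
        gradPoly F i * (C (A (Pi.single l 1) (Pi.single k 1) i) * X k)) := by
      intro k
      rw [mul_right_comm, ← hder k l, Finset.sum_mul]
      refine Finset.sum_congr rfl fun i _ => ?_
      rw [hA.1 (Pi.single k 1) (Pi.single l 1)]
      ring
    simp_rw [this]
    rw [Finset.sum_comm]
    simp only [Finset.sum_add_distrib, ← Finset.mul_sum, Matrix.mulVec, dotProduct, hQ, linForms]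
  have hHV : hessePoly F *ᵥ V = fun l => C (-2 * c l) * F := by
    rw [hV, Matrix.mulVec_sub, Matrix.mulVec_smul, Matrix.mulVec_smul, hessePoly_mulVec_X hF]
    funext l
    have h2 : (C (-2 : ℂ) : MvPolynomial (Fin (N + 1)) ℂ) = -2 := by
      rw [map_neg, map_ofNat]
    simp only [Pi.sub_apply, Pi.smul_apply, smul_eq_mul, C_mul, h2]
    linear_combination 2 * hHQ l
  have hVhom : ∀ i, (V i).IsHomogeneous 2 := by
    intro i
    have h2 : (C (2 : ℂ) : MvPolynomial (Fin (N + 1)) ℂ) = 2 := map_ofNat C 2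
    simp only [hV, Pi.sub_apply, Pi.smul_apply, smul_eq_mul, ← h2]
    refine IsHomogeneous.sub (IsHomogeneous.C_mul ?_ _) ?_
    · exact IsHomogeneous.sum _ _ _ fun k _ =>
        (isHomogeneous_X ℂ k).mul (linForms_isHomogeneous A k i)
    · exact (IsHomogeneous.sum _ _ 1 fun k _ => isHomogeneous_C_mul_X _ _).mul
        (isHomogeneous_X ℂ i)
  by_contra hdet
  have hV0 : V = 0 := by
    funext i
    refine eq_zero_of_dvd_of_lt hF (hVhom i) (by norm_num) ?_
    refine (hirr.prime.dvd_or_dvd ?_).resolve_left hdet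
    -- The adjugate turns `H V ≡ 0` into `det H • V ≡ 0` modulo the prime `F`.
    have h := congrArg (fun v => ((hessePoly F).adjugate *ᵥ v) i) hHV
    simp only [Matrix.mulVec_mulVec, Matrix.adjugate_mul, Matrix.smul_mulVec, Matrix.one_mulVec,
      Pi.smul_apply, smul_eq_mul] at h
    rw [h]
    simp only [Matrix.mulVec, dotProduct]
    exact Finset.dvd_sum fun j _ => dvd_mul_of_dvd_right (dvd_mul_left F _) _
  have hc0 : ∀ l, c l = 0 := by
    intro l
    have h := congrFun hHV l
    rw [hV0, Matrix.mulVec_zero, Pi.zero_apply] at h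
    have := (mul_eq_zero.1 h.symm).resolve_right hirr.ne_zero
    simpa using this
  have hQ0 : ∀ i, Q i = 0 := by
    intro i
    have h := congrFun hV0 i
    simpa [hV, hL, hc0] using h
  have hdiag : ∀ y, A y y = 0 := by
    intro y
    funext i
    have h := congrArg (eval y) (hQ0 i)
    simp only [hQ, map_sum, map_mul, eval_X, eval_linForms, map_zero] at h
    rw [Pi.zero_apply, ← h]
    have hy : A y = ∑ k, y k • A (Pi.single k 1) := by
      conv_lhs => rw [pi_eq_sum_univ' y]
      rw [map_sum]
      refine Finset.sum_congr rfl fun k _ => ?_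
      rw [map_smul]
    rw [hy]
    simp [LinearMap.sum_apply, Finset.sum_apply]
  -- Polarization recovers `A` from its diagonal.
  refine hA0 (LinearMap.ext fun u => LinearMap.ext fun w => ?_)
  have h := hdiag (u + w)
  simp only [map_add, LinearMap.add_apply, hdiag, zero_add, add_zero, hA.1 w u] at h
  rw [← two_smul ℂ] at h
  simpa using h

/-- On a cubic hypersurface with vanishing Hessian the form `F(y, ·, ·)` has a kernel vector
independent of `y` at each smooth point `y`. -/
theorem exists_hesseMatrix_mulVec_eq_zero {F : MvPolynomial (Fin (N + 1)) ℂ}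
    (hF : F.IsHomogeneous 3) (hdet : F ∣ (hessePoly F).det) {y : W N} (hy : y ∈ smoothLocus F) :
    ∃ v : W N, v ∉ Submodule.span ℂ {y} ∧ hesseMatrix F y *ᵥ v = 0 := by
  have h0 : (hesseMatrix F y).det = 0 := by
    obtain ⟨P, hP⟩ := hdet
    have hy0 : eval y F = 0 := hy.1
    have := congrArg (eval y) hP
    rw [map_mul, hy0, zero_mul, RingHom.map_det] at this
    exact this
  obtain ⟨v, hv0, hv⟩ := Matrix.exists_mulVec_eq_zero_iff.2 h0
  refine ⟨v, fun hmem => ?_, hv⟩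
  obtain ⟨t, rfl⟩ := Submodule.mem_span_singleton.1 hmem
  rw [Matrix.mulVec_smul, hesseMatrix_mulVec_self hF, smul_smul] at hv
  rcases smul_eq_zero.1 hv with h | h
  · exact hv0 (by rw [(mul_eq_zero.1 h).resolve_right two_ne_zero, zero_smul])
  · exact hy.2 h

end CubicHypersurface

end

/-! ### Dimension of the dual variety via differentials. -/

noncomputable section

/-- An integral ring extension does not raise the Krull dimension. -/
theorem ringKrullDim_le_of_isIntegral {R S : Type*} [CommRing R] [CommRing S] (f : R →+* S)
    (hf : f.IsIntegral) : ringKrullDim S ≤ ringKrullDim R := by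
  let _ : Algebra R S := f.toAlgebra
  have : Algebra.IsIntegral R S := ⟨hf⟩
  -- Incomparability: contraction along an integral map preserves strict inclusions of primes.
  refine Order.krullDim_le_of_strictMono (PrimeSpectrum.comap (algebraMap R S)) fun I J hIJ => ?_
  exact Ideal.IsIntegral.comap_lt_comap (R := R) (I := I.asIdeal) (J := J.asIdeal) hIJ

open KaehlerDifferential TensorProduct in
/-- In characteristic zero, algebraically independent elements of a finitely generated field
extension have linearly independent differentials. -/
theorem AlgebraicIndependent.linearIndependent_D {k K ι : Type*} [Field k] [CharZero k] [Field K]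
    [Algebra k K] [Algebra.EssFiniteType k K] {g : ι → K} (hg : AlgebraicIndependent k g) :
    LinearIndependent K fun i => D k K (g i) := by
  let φ : MvPolynomial ι k →ₐ[k] K := aeval g
  let _ : Algebra (MvPolynomial ι k) K := φ.toRingHom.toAlgebra
  have hmap : ∀ P, algebraMap (MvPolynomial ι k) K P = aeval g P := fun P => rfl
  have : IsScalarTower k (MvPolynomial ι k) K :=
    IsScalarTower.of_algebraMap_eq' φ.comp_algebraMap.symm
  have : FaithfulSMul (MvPolynomial ι k) K := (faithfulSMul_iff_algebraMap_injective _ _).2 hg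
  let M := FractionRing (MvPolynomial ι k)
  let _ : Algebra M K := FractionRing.liftAlgebra _ _
  have : IsScalarTower k M K := by
    refine IsScalarTower.of_algebraMap_eq' ?_
    rw [IsScalarTower.algebraMap_eq k (MvPolynomial ι k) K,
      IsScalarTower.algebraMap_eq (MvPolynomial ι k) M K, RingHom.comp_assoc,
      ← IsScalarTower.algebraMap_eq]
  have : Algebra.EssFiniteType M K := Algebra.EssFiniteType.of_comp k M K
  have : CharZero M := charZero_of_injective_algebraMap (algebraMap k M).injective
  -- In characteristic zero `K` is formally smooth over `M`, hence over the polynomial ring; then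
  -- `H1Cotangent` vanishes and differentials inject after base change.
  have : Algebra.FormallySmooth M K := inferInstance
  have : Algebra.FormallySmooth (MvPolynomial ι k) M := .of_isLocalization (nonZeroDivisors _)
  have : Algebra.FormallySmooth (MvPolynomial ι k) K := .comp _ M _
  have hinj : Function.Injective (mapBaseChange k (MvPolynomial ι k) K) := by
    rw [injective_iff_map_eq_zero]
    intro x hx
    obtain ⟨z, rfl⟩ := (Algebra.H1Cotangent.exact_δ_mapBaseChange k (MvPolynomial ι k) K x).1 hx
    rw [Subsingleton.elim z 0, map_zero]
  have hli := ((mvPolynomialBasis k ι).baseChange K).linearIndependent.map' _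
    (LinearMap.ker_eq_bot.2 hinj)
  have heq : (fun i => D k K (g i)) = mapBaseChange k (MvPolynomial ι k) K ∘
      (mvPolynomialBasis k ι).baseChange K := by
    funext i
    simp [Module.Basis.baseChange_apply, mvPolynomialBasis_apply, hmap]
  rw [heq]
  exact hli

/-- The chain rule for derivations and polynomials in several variables. -/
theorem Derivation.map_mvPolynomial_aeval {k K M σ : Type*} [CommRing k] [CommRing K] [Algebra k K]
    [AddCommGroup M] [Module k M] [Module K M] [Fintype σ] (D : Derivation k K M)
    (x : σ → K) (P : MvPolynomial σ k) :
    D (aeval x P) = ∑ l, aeval x (pderiv l P) • D (x l) := by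
  classical
  induction P using MvPolynomial.induction_on with
  | C a => simp
  | add p q hp hq => simp [hp, hq, add_smul, Finset.sum_add_distrib]
  | mul_X p i hp =>
    simp [hp, pderiv_X, Pi.single_apply, add_smul, Finset.sum_add_distrib,
      Finset.smul_sum, mul_comm, mul_smul, apply_ite, ite_smul, add_comm]

/-- A form of degree `d` satisfies `P(c v) = c ^ d P(v)`. -/
theorem MvPolynomial.IsHomogeneous.eval_smul {σ R : Type*} [CommRing R] {P : MvPolynomial σ R}
    {d : ℕ} (hP : P.IsHomogeneous d) (c : R) (v : σ → R) :
    eval (c • v) P = c ^ d * eval v P := by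
  rw [eval_eq, eval_eq, Finset.mul_sum]
  refine Finset.sum_congr rfl fun m hm => ?_
  have hd : ∑ i ∈ m.support, m i = d := by
    have := hP (mem_support_iff.1 hm)
    rw [Finsupp.weight_apply, Finsupp.sum] at this
    simpa using this
  simp only [Pi.smul_apply, smul_eq_mul, mul_pow, Finset.prod_mul_distrib,
    Finset.prod_pow_eq_pow_sum, hd]
  ring

namespace CubicHypersurface

variable {N : ℕ}

theorem gradient_smul {F : MvPolynomial (Fin (N + 1)) ℂ} (hF : F.IsHomogeneous 3) (t : ℂ)
    (y : W N) : gradient F (t • y) = t ^ 2 • gradient F y :=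
  funext fun i => (hF.pderiv (i := i)).eval_smul t y

theorem eval_gradient {F P : MvPolynomial (Fin (N + 1)) ℂ} (y : W N) :
    eval (gradient F y) P = eval y (aeval (gradPoly F) P) := by
  have h := comp_aeval_apply (f := gradPoly F) (aeval (R := ℂ) y) P
  exact h.symm

/-- The zero set of `P` need not be a cone, but `∇F` maps the cone `F = 0` into it and scales by
`t²` along lines; this separates the homogeneous components. -/
theorem eval_gradient_homogeneousComponent {F P : MvPolynomial (Fin (N + 1)) ℂ}
    (hF : F.IsHomogeneous 3) (hP : F ∣ aeval (gradPoly F) P) {y : W N} (hy : eval y F = 0)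
    (d : ℕ) : eval (gradient F y) (homogeneousComponent d P) = 0 := by
  rcases lt_or_ge P.totalDegree d with hd | hd
  · rw [homogeneousComponent_eq_zero d P hd, map_zero]
  set a : ℕ → ℂ := fun e => eval (gradient F y) (homogeneousComponent e P) with ha
  -- A polynomial in `s = t²`; it vanishes identically since every complex `s` is a square.
  have key : ∑ e ∈ Finset.range (P.totalDegree + 1),
      Polynomial.C (a e) * Polynomial.X ^ e = 0 := by
    refine Polynomial.funext fun s => ?_
    obtain ⟨t, rfl⟩ := IsAlgClosed.exists_pow_nat_eq s two_pos
    obtain ⟨Q, hQ⟩ := hP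
    have h : eval (gradient F (t • y)) P = 0 := by
      rw [eval_gradient, hQ, map_mul, hF.eval_smul, hy, mul_zero, zero_mul]
    rw [gradient_smul hF, ← sum_homogeneousComponent P, map_sum] at h
    rw [Polynomial.eval_finsetSum, Polynomial.eval_zero, ← h]
    refine Finset.sum_congr rfl fun e _ => ?_
    rw [(homogeneousComponent_isHomogeneous e P).eval_smul]
    rw [Polynomial.eval_mul, Polynomial.eval_C, Polynomial.eval_pow, Polynomial.eval_X, mul_comm]
  have := congrArg (fun p => p.coeff d) key
  simpa [Polynomial.finsetSum_coeff, Polynomial.coeff_X_pow, Nat.lt_succ_iff, hd] using this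

/-- The polynomial relations between the partial derivatives of `F` modulo `F` lie in the
homogeneous ideal of the dual variety. -/
theorem mem_homogeneousIdeal_dualVariety {F P : MvPolynomial (Fin (N + 1)) ℂ}
    (hF : F.IsHomogeneous 3) (hP : F ∣ aeval (gradPoly F) P) :
    P ∈ homogeneousIdeal (dualVariety F) := by
  rw [← sum_homogeneousComponent P]
  refine Ideal.sum_mem _ fun d _ => Ideal.subset_span ⟨⟨d, homogeneousComponent_isHomogeneous d P⟩,
    fun p hp => hp d _ (homogeneousComponent_isHomogeneous d P) ?_⟩
  rintro q ⟨y, hy, rfl⟩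
  obtain ⟨u, hu⟩ := Projectivization.exists_smul_eq_mk_rep ℂ (gradient F y) hy.2
  rw [← hu, Units.smul_def, (homogeneousComponent_isHomogeneous d P).eval_smul,
    eval_gradient_homogeneousComponent hF hP hy.1, mul_zero]

/-- An irreducible hypersurface has a generic point with values in a finitely generated field
extension. -/
theorem exists_generic_point {σ k : Type} [Finite σ] [Field k] {F : MvPolynomial σ k}
    (hirr : Irreducible F) : ∃ (K : Type) (_ : Field K) (_ : Algebra k K)
      (_ : Algebra.EssFiniteType k K) (x : σ → K), ∀ P, aeval x P = 0 ↔ F ∣ P := by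
  have hprime : (Ideal.span {F}).IsPrime :=
    (Ideal.span_singleton_prime hirr.ne_zero).2 hirr.prime
  let φ : MvPolynomial σ k →ₐ[k] FractionRing (MvPolynomial σ k ⧸ Ideal.span {F}) :=
    (IsScalarTower.toAlgHom k _ _).comp (Ideal.Quotient.mkₐ k (Ideal.span {F}))
  refine ⟨FractionRing (MvPolynomial σ k ⧸ Ideal.span {F}), inferInstance, inferInstance,
    inferInstance, fun l => φ (X l), fun P => ?_⟩
  have hφ : aeval (fun l => φ (X l)) = φ := MvPolynomial.algHom_ext fun l => by simp
  rw [hφ, ← Ideal.mem_span_singleton, ← Ideal.Quotient.eq_zero_iff_mem,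
    ← map_eq_zero_iff _ (IsFractionRing.injective (MvPolynomial σ k ⧸ Ideal.span {F})
      (FractionRing (MvPolynomial σ k ⧸ Ideal.span {F})))]
  rfl

open KaehlerDifferential in
/-- If the Hessian vanishes on an irreducible cubic hypersurface, at most `N - 1` polynomials in
the partial derivatives are algebraically independent on its affine cone. -/
theorem card_lt_of_algebraicIndependent {F : MvPolynomial (Fin (N + 1)) ℂ}
    (hF : F.IsHomogeneous 3) (hirr : Irreducible F) (hdet : F ∣ (hessePoly F).det)
    {K : Type*} [Field K] [Algebra ℂ K] [Algebra.EssFiniteType ℂ K] {x : Fin (N + 1) → K}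
    (hx : ∀ P, aeval x P = 0 ↔ F ∣ P) {s : ℕ} {G : Fin s → MvPolynomial (Fin (N + 1)) ℂ}
    (hG : AlgebraicIndependent ℂ fun i => aeval x (aeval (gradPoly F) (G i))) : s < N := by
  set H : Matrix (Fin (N + 1)) (Fin (N + 1)) K := (hessePoly F).map (aeval x) with hH
  set ψ : (Fin (N + 1) → K) →ₗ[K] Ω[K⁄ℂ] :=
    Fintype.linearCombination K (fun l => D ℂ K (x l)) with hψ
  -- By the chain rule, the range of `θ` contains the differentials of all polynomials in the
  -- partials.
  set θ := ψ ∘ₗ H.mulVecLin with hθ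
  have hDgrad : ∀ l, D ℂ K (aeval x (gradPoly F l)) = θ (Pi.single l 1) := by
    intro l
    rw [Derivation.map_mvPolynomial_aeval]
    simp [hθ, hψ, hH, Fintype.linearCombination_apply, hessePoly, gradPoly]
  have hHx : H *ᵥ x = (2 : K) • fun l => aeval x (gradPoly F l) := by
    funext i
    have h := congrArg (aeval x) (congrFun (hessePoly_mulVec_X hF) i)
    simpa [Matrix.mulVec, dotProduct, hH] using h
  have hψgrad : ψ (fun l => aeval x (gradPoly F l)) = 0 := by
    have h := (D ℂ K).map_mvPolynomial_aeval x F
    rw [(hx F).2 dvd_rfl, map_zero] at h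
    simpa [hψ, Fintype.linearCombination_apply, gradPoly] using h.symm
  have hgrad0 : (fun l => aeval x (gradPoly F l)) ≠ 0 := by
    intro h
    have h0 : ∀ l, gradPoly F l = 0 := fun l =>
      eq_zero_of_dvd_of_lt hF (hF.pderiv (i := l)) (by norm_num) ((hx _).1 (congrFun h l))
    have h3 := hF.sum_X_mul_pderiv
    simp only [gradPoly] at h0
    simp only [h0, mul_zero, Finset.sum_const_zero] at h3
    exact hirr.ne_zero (by simpa using h3.symm)
  have hdetH : H.det = 0 := by
    rw [hH, ← AlgHom.mapMatrix_apply, ← AlgHom.map_det]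
    exact (hx _).2 hdet
  have hker : LinearMap.ker H.mulVecLin ≠ ⊥ := by
    obtain ⟨v, hv0, hv⟩ := Matrix.exists_mulVec_eq_zero_iff.2 hdetH
    exact fun h => hv0 ((Submodule.mem_bot K).1 (h ▸ (LinearMap.mem_ker.2 hv)))
  -- The generic point `x` is the extra kernel vector: `H x = 2 ∇F(x) ≠ 0`, while `ψ` maps `∇F(x)`
  -- to `d(F(x)) = 0`. So `ker θ` has dimension at least 2.
  have hlt : LinearMap.ker H.mulVecLin < LinearMap.ker θ := by
    refine lt_of_le_of_ne (LinearMap.ker_le_ker_comp _ _) fun h => ?_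
    have hxmem : x ∈ LinearMap.ker θ := by
      rw [LinearMap.mem_ker, hθ, LinearMap.comp_apply, Matrix.mulVecLin_apply, hHx, map_smul,
        hψgrad, smul_zero]
    rw [← h, LinearMap.mem_ker, Matrix.mulVecLin_apply, hHx] at hxmem
    have : CharZero K := charZero_of_injective_algebraMap (algebraMap ℂ K).injective
    exact hgrad0 ((smul_eq_zero.1 hxmem).resolve_left two_ne_zero)
  have h1 : 0 < Module.finrank K (LinearMap.ker H.mulVecLin) :=
    Nat.pos_of_ne_zero fun h => hker (Submodule.finrank_eq_zero.1 h)
  have h2 := Submodule.finrank_lt_finrank_of_lt hlt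
  have h3 := θ.finrank_range_add_finrank_ker
  rw [Module.finrank_fin_fun] at h3
  have hmem : ∀ i, D ℂ K (aeval x (aeval (gradPoly F) (G i))) ∈ LinearMap.range θ := by
    intro i
    rw [comp_aeval_apply, Derivation.map_mvPolynomial_aeval]
    refine Submodule.sum_mem _ fun l _ => Submodule.smul_mem _ _ ?_
    rw [hDgrad]
    exact LinearMap.mem_range_self _ _
  have hli : LinearIndependent K fun i => (⟨_, hmem i⟩ : LinearMap.range θ) :=
    LinearIndependent.of_comp (LinearMap.range θ).subtype hG.linearIndependent_D
  have h4 := hli.fintype_card_le_finrank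
  rw [Fintype.card_fin] at h4
  omega

/-- An irreducible cubic hypersurface with vanishing Hessian on it is dual defective. -/
theorem isDualDefective_of_dvd_det_hessePoly {F : MvPolynomial (Fin (N + 1)) ℂ}
    (hF : F.IsHomogeneous 3) (hirr : Irreducible F) (hdet : F ∣ (hessePoly F).det) :
    IsDualDefective F := by
  rw [IsDualDefective, coneDim]
  set I := homogeneousIdeal (dualVariety F)
  rcases subsingleton_or_nontrivial (MvPolynomial (Fin (N + 1)) ℂ ⧸ I) with hs | hn
  · rw [ringKrullDim_eq_bot_of_subsingleton]
    exact WithBot.bot_lt_coe _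
  -- Noether normalization; it remains to lift the `s` parameters to polynomials and pull them back
  -- along `∇F` to the generic point.
  obtain ⟨s, g, hinj, hint⟩ :=
    exists_integral_inj_algHom_of_fg ℂ (MvPolynomial (Fin (N + 1)) ℂ ⧸ I)
  have hle : ringKrullDim (MvPolynomial (Fin (N + 1)) ℂ ⧸ I) ≤ s := by
    refine (ringKrullDim_le_of_isIntegral g.toRingHom hint).trans ?_
    rw [MvPolynomial.ringKrullDim_of_isNoetherianRing, ringKrullDim_eq_zero_of_field]
    simp
  refine hle.trans_lt ?_
  suffices s < N by exact_mod_cast this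
  choose G hG using fun i : Fin s => Ideal.Quotient.mkₐ_surjective ℂ I (g (X i))
  obtain ⟨K, _, _, _, x, hx⟩ := exists_generic_point hirr
  refine card_lt_of_algebraicIndependent hF hirr hdet hx (G := G) ?_
  rw [AlgebraicIndependent, injective_iff_map_eq_zero]
  intro p hp
  -- A relation among the pullbacks holds modulo `F`, hence already in the coordinate ring of the
  -- dual variety.
  have hrel : F ∣ aeval (gradPoly F) (aeval G p) := by
    rw [← hx, comp_aeval_apply (f := G), comp_aeval_apply]
    exact hp
  have h0 := Ideal.Quotient.eq_zero_iff_mem.2 (mem_homogeneousIdeal_dualVariety hF hrel)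
  rw [← Ideal.Quotient.mkₐ_eq_mk ℂ, comp_aeval_apply] at h0
  simp only [I] at hG
  simp only [hG] at h0
  rw [← comp_aeval_apply, aeval_X_left_apply] at h0
  exact (map_eq_zero_iff g hinj).1 h0

end CubicHypersurface

end

theorem proposition3p1 (N : ℕ) (F : MvPolynomial (Fin (N + 1)) ℂ)
    (hF : F.IsHomogeneous 3) (hirr : Irreducible F)
    (hA : CubicHypersurface.prolongation (CubicHypersurface.infAut F) ≠ ⊥) :
    CubicHypersurface.IsDualDefective F ∧
      ∀ y ∈ CubicHypersurface.smoothLocus F,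
        ∃ v : Fin (N + 1) → ℂ, v ∉ Submodule.span ℂ {y} ∧
          CubicHypersurface.hesseMatrix F y *ᵥ v = 0 := by
  obtain ⟨A, hAmem, hA0⟩ := Submodule.exists_mem_ne_zero_of_ne_bot hA
  have hdet := CubicHypersurface.dvd_det_hessePoly hF hirr hAmem hA0
  exact ⟨CubicHypersurface.isDualDefective_of_dvd_det_hessePoly hF hirr hdet,
    fun y hy => CubicHypersurface.exists_hesseMatrix_mulVec_eq_zero hF hdet hy⟩
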